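/- Let $n\ge 1$ and let $x_0,x_1,\dots,x_n$ be nonnegative reals with $x_0>0$ and $x_1>0$. For a state $c=(c_1,\dots,c_n)\in\mathbb Z_{\ge0}^n$ set $U_0(c)=(0,c_1,\dots,c_{n-1})$ and, for $1\le j\le n$, $U_j(c)=(c_1,\dots,c_{j-1},c_j+1,c_{j+1},\dots,c_n)$. The Hilbert–Galton board $Z^{(n)}$ is the continuous-time Markov chain on $\mathbb Z_{\ge0}^n$ which jumps from $c$ to $U_j(c)$ at rate $x_j$, for each $0\le j\le n$. A triangular array of size $m\ge 0$ is a family $A=(A_{k,j})_{1\le j\le k\le m}$ of nonnegative integers. For $1\le i\le m$ put $$h_i(A)=\sum_{j=1}^{i}A_{i,j},\qquad v_i(A)=\sum_{k=i}^{m}A_{k,i},\qquad d_i(A)=\sum_{j=1}^{i}A_{m-i+j,j},$$ let $H_m(c_1,\dots,c_m)$ be the (finite) set of triangular arrays $A$ of size $m$ with $h_i(A)=c_i$ for all $1\le i\le m$, and, for $m\le n$, put $$w_x(A)=x_0^{m}\prod_{k=1}^{m}\binom{d_k(A)}{A_{m-k+1,1},\,A_{m-k+2,2},\dots,A_{m,k}}\frac{x_k^{v_k(A)}}{y_k^{d_k(A)+1}},\qquad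 y_k=x_0+x_1+\dots+x_k,$$ with $0^0=1$. Theorem. The chain $Z^{(n)}$ is irreducible and positive recurrent (for every state $c$, the return time to $c$ of the chain started at $c$ has finite expectation). It has a unique stationary distribution $\pi$, and for every $(c_1,\dots,c_n)\in\mathbb Z_{\ge0}^n$ $$\pi(c_1,\dots,c_n)=\sum_{A\in H_n(c_1,\dots,c_n)}w_x(A).$$ More generally, for every $1\le\ell\le n$ and $(c_1,\dots,c_\ell)\in\mathbb Z_{\ge0}^\ell$, $$\pi\bigl(\{z\in\mathbb Z_{\ge0}^n : z_i=c_i\text{ for all }1\le i\le\ell\}\bigr)=\sum_{A\in H_\ell(c_1,\dots,c_\ell)}w_x(A).$$ -/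

import Mathlib

open MeasureTheory
open scoped ENNReal NNReal Topology

noncomputable section

namespace HilbertGalton

/-! ### Continuous-time Markov chains with finitely many transition maps, each used at a fixed rate -/

section Chain

variable {S : Type*}

/-- The infinitesimal generator of the continuous-time Markov chain on the countable set `S` which,
for each `j : ι`, jumps from its current state `c` to `U j c` at rate `r j`:
`(L f) c = ∑ j, r j * (f (U j c) - f c)`. -/
def generator {ι : Type*} [Fintype ι] (r : ι → ℝ) (U : ι → S → S) : (S → ℝ) →ₗ[ℝ] (S → ℝ) where
  toFun f c := ∑ j, r j * (f (U j c) - f c)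
  map_add' f g := by
    funext c
    simp only [Pi.add_apply, ← Finset.sum_add_distrib]
    exact Finset.sum_congr rfl fun j _ => by ring
  map_smul' a f := by
    funext c
    simp only [Pi.smul_apply, smul_eq_mul, RingHom.id_apply, Finset.mul_sum]
    exact Finset.sum_congr rfl fun j _ => by ring

/-- The transition probability `P_t(c, d)` of the continuous-time Markov chain with generator `L`:
the entry at `(c, d)` of `exp (t L) = ∑ k, t ^ k / k! * L ^ k`. The total jump rate of the chains
defined by `generator` is the same at all states, so the operator `L` is bounded for the supremum
norm, the series converges absolutely, and it gives the only transition function with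
generator `L`. -/
def transProb (L : (S → ℝ) →ₗ[ℝ] (S → ℝ)) (t : ℝ≥0) (c d : S) : ℝ :=
  ∑' k : ℕ, (t : ℝ) ^ k / (k.factorial : ℝ) * (L ^ k) (Set.indicator {d} 1) c

/-- Every state leads to every state: from `c`, the chain is at `d` at some time with positive
probability. -/
def IsIrreducible (L : (S → ℝ) →ₗ[ℝ] (S → ℝ)) : Prop :=
  ∀ c d : S, ∃ t : ℝ≥0, 0 < transProb L t c d

/-- `π` is a stationary distribution: `π P_t = π` for all `t ≥ 0`. -/
def IsStationary (L : (S → ℝ) →ₗ[ℝ] (S → ℝ)) (π : PMF S) : Prop :=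
  ∀ (t : ℝ≥0) (d : S), ∑' c, π c * ENNReal.ofReal (transProb L t c d) = π d

/-- `Z` is (a version of) the continuous-time Markov chain with generator `L` started at `c₀`:
almost all paths are right-continuous (for the discrete topology of `S`), and the
finite-dimensional distributions are the products of transition probabilities,
`μ (Z 0 = s 0, Z (u 0) = s 1, …, Z (u 0 + ⋯ + u (m-1)) = s m)
  = P_{u 0}(s 0, s 1) ⋯ P_{u (m-1)}(s (m-1), s m)` whenever `s 0 = c₀`. The case `m = 0` says
that `Z 0 = c₀` almost surely. -/
structure IsMarkovChain [MeasurableSpace S] (L : (S → ℝ) →ₗ[ℝ] (S → ℝ)) (c₀ : S)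
    {Ω : Type*} [MeasurableSpace Ω] (μ : Measure Ω) (Z : ℝ≥0 → Ω → S) : Prop where
  isProbabilityMeasure : IsProbabilityMeasure μ
  measurable : ∀ t, Measurable (Z t)
  rightContinuous : ∀ᵐ ω ∂μ, ∀ t, ∀ᶠ t' in 𝓝[≥] t, Z t' ω = Z t ω
  law : ∀ (m : ℕ) (u : ℕ → ℝ≥0) (s : ℕ → S), s 0 = c₀ →
    μ {ω | ∀ i ≤ m, Z (∑ k ∈ Finset.range i, u k) ω = s i}
      = ENNReal.ofReal (∏ i ∈ Finset.range m, transProb L (u i) (s i) (s (i + 1)))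

/-- The first time at which the path `z` is not at `c` (infinite if there is none). -/
def exitTime {S : Type*} (z : ℝ≥0 → S) (c : S) : ℝ≥0∞ :=
  ⨅ (t : ℝ≥0) (_ : z t ≠ c), (t : ℝ≥0∞)

/-- The return time to `c` of a path `z` that starts at `c`: the first time, after `c` has been
left, at which the path is at `c` (infinite if there is none). -/
def returnTime {S : Type*} (z : ℝ≥0 → S) (c : S) : ℝ≥0∞ :=
  ⨅ (t : ℝ≥0) (_ : exitTime z c ≤ t) (_ : z t = c), (t : ℝ≥0∞)

/-- For every state `c`, the return time to `c` of the chain started at `c` has finite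
expectation. (This expectation depends only on the law of the chain. Absorbing states need no
separate convention, as a chain in which some map is used at a positive rate and has no fixed
point has none.) -/
def IsPositiveRecurrent [MeasurableSpace S] (L : (S → ℝ) →ₗ[ℝ] (S → ℝ)) : Prop :=
  ∀ (c : S) (Ω : Type) [MeasurableSpace Ω] (μ : Measure Ω) (Z : ℝ≥0 → Ω → S),
    IsMarkovChain L c μ Z → ∫⁻ ω, returnTime (fun t => Z t ω) c ∂μ < ∞

end Chain

/-! ### The Hilbert-Galton board

Bin number `i` of the mathematical notation, `1 ≤ i ≤ n`, is the index `i - 1 : Fin n`. -/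

/-- The transition maps `U_0, …, U_n`: `U_0` shifts all bins to the right, deletes the last one and
adds an empty bin on the left; `U_j`, `j ≥ 1`, adds a ball to bin number `j`. -/
def boardMap {n : ℕ} (j : Fin (n + 1)) (c : Fin n → ℕ) : Fin n → ℕ := fun i =>
  if j.val = 0 then
    if i.val = 0 then 0 else c ⟨i.val - 1, lt_of_le_of_lt (Nat.sub_le _ _) i.isLt⟩
  else
    if i.val + 1 = j.val then c i + 1 else c i

/-- The generator of the Hilbert-Galton board with `n` bins and rates `x 0, …, x n`. -/
def board (n : ℕ) (x : ℕ → ℝ) : ((Fin n → ℕ) → ℝ) →ₗ[ℝ] ((Fin n → ℕ) → ℝ) :=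
  generator (fun j : Fin (n + 1) => x j.val) boardMap

/-! ### Triangular arrays -/

/-- Triangular arrays `(A_{k,j})`, `1 ≤ j ≤ k ≤ n`, of nonnegative integers. The entry `A_{k,j}` is
`A (k - 1) (j - 1)`: the row of index `k : Fin n` has `k + 1` entries. -/
abbrev TriArray (n : ℕ) : Type := (k : Fin n) → Fin (k.val + 1) → ℕ

namespace TriArray

variable {n : ℕ}

/-- The row sum `h_i(A)`. -/
def rowSum (A : TriArray n) (i : Fin n) : ℕ := ∑ j, A i j

/-- The column sum `v_i(A)`. -/
def colSum (A : TriArray n) (i : Fin n) : ℕ :=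
  ∑ k : Fin n, if h : i.val ≤ k.val then A k ⟨i.val, Nat.lt_succ_of_le h⟩ else 0

/-- The `i`-th diagonal `(A_{n-i+1,1}, A_{n-i+2,2}, …, A_{n,i})` (here for `i = i.val + 1`). -/
def diag (A : TriArray n) (i : Fin n) : Fin (i.val + 1) → ℕ := fun j =>
  A ⟨n - 1 - i.val + j.val, by omega⟩ ⟨j.val, by simp only; omega⟩

/-- The diagonal sum `d_i(A)`. -/
def diagSum (A : TriArray n) (i : Fin n) : ℕ := ∑ j, A.diag i j

/-- The finite set `H_n(c)` of the triangular arrays with row sums `c`, see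
`mem_withRowSums`. -/
def withRowSums (c : Fin n → ℕ) : Finset (TriArray n) :=
  Fintype.piFinset fun k => Finset.piAntidiag Finset.univ (c k)

theorem mem_withRowSums (c : Fin n → ℕ) (A : TriArray n) :
    A ∈ withRowSums c ↔ ∀ i, A.rowSum i = c i := by
  simp [withRowSums, rowSum]

/-- The weight `w_x(A)`, where `y_k = x_0 + ⋯ + x_k`. -/
def weight (x : ℕ → ℝ) (A : TriArray n) : ℝ :=
  x 0 ^ n * ∏ k : Fin n, (Nat.multinomial Finset.univ (A.diag k) : ℝ) *
    (x (k.val + 1) ^ A.colSum k /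
      (∑ i ∈ Finset.range (k.val + 2), x i) ^ (A.diagSum k + 1))

end TriArray

end HilbertGalton

end

/-! The total jump rate `λ` is the same at every state, so `L = Q - λ` with `Q = jumpOp r U`, and
`P_t = e^{-λt} ∑ t^k / k! Q^k` (`transProb_generator`). Questions about the chain thereby become
questions about powers of the nonnegative operator `Q`.

Qualitative part: enough shifts empty the board from any state, and any given state `d` can then be
built with shifts and insertions into bin 1. The number of jumps does not depend on the starting
state, so `P_1(c, d) ≥ δ` with `δ > 0` depending only on `d`. This Doeblin minorization gives
irreducibility, uniqueness of the stationary law, and geometric tails for the return time.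

Stationary law: read `A_{k,j}` as the number of balls now in bin `k` that were inserted in bin `j`.
A diagonal collects the balls inserted between the same two consecutive shifts. These groups are
independent, and the group inserted into bins `1, …, k` has the law `geomMultinomial r k`: a
geometric number of balls, each put in bin `j` with probability proportional to `x_j`. The weight is
the product of these laws over the diagonals (`TriArray.weight_extend`). The state is thus `D + (0,
c)`, with `D` the balls inserted since the last shift and `c` an independent state of a board with
one bin fewer. For fixed `c`, balance reduces to a chain on `D` that adds balls and is reset to `0`
at rate `x_0` (`tsum_geomMultinomial_balance`). Forgetting the last bin gives the law of the smaller
board, whence both the shift term of the balance equation and the formula for cylinders. -/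

namespace HilbertGalton

/-! ### Uniformization and global balance -/

section JumpOperator

variable {S ι : Type*} [Fintype ι]

/-- The operator `f ↦ ∑ j, r j * f (U j ·)`. -/
def jumpOp (r : ι → ℝ) (U : ι → S → S) : (S → ℝ) →ₗ[ℝ] (S → ℝ) where
  toFun f c := ∑ j, r j * f (U j c)
  map_add' f g := by
    funext c
    simp only [Pi.add_apply, ← Finset.sum_add_distrib, mul_add]
  map_smul' a f := by
    funext c
    simp only [Pi.smul_apply, smul_eq_mul, RingHom.id_apply, Finset.mul_sum]
    exact Finset.sum_congr rfl fun j _ => by ring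

theorem jumpOp_apply (r : ι → ℝ) (U : ι → S → S) (f : S → ℝ) (c : S) :
    jumpOp r U f c = ∑ j, r j * f (U j c) := rfl

theorem jumpOp_pow_succ_apply (r : ι → ℝ) (U : ι → S → S) (k : ℕ) (f : S → ℝ) (c : S) :
    (jumpOp r U ^ (k + 1)) f c = ∑ j, r j * (jumpOp r U ^ k) f (U j c) := by
  rw [pow_succ', Module.End.mul_apply, jumpOp_apply]

theorem generator_eq (r : ι → ℝ) (U : ι → S → S) :
    generator r U = algebraMap ℝ _ (-∑ j, r j) + jumpOp r U := by
  ext f c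
  simp only [generator, jumpOp, LinearMap.coe_mk, AddHom.coe_mk, LinearMap.add_apply,
    Module.algebraMap_end_apply, Pi.add_apply, Pi.smul_apply, smul_eq_mul, mul_sub,
    Finset.sum_sub_distrib, Finset.sum_mul, neg_mul]
  ring

variable {r : ι → ℝ} (hr : ∀ j, 0 ≤ r j) (U : ι → S → S)

include hr

theorem jumpOp_pow_mono (k : ℕ) {f g : S → ℝ} (h : ∀ c, f c ≤ g c) (c : S) :
    (jumpOp r U ^ k) f c ≤ (jumpOp r U ^ k) g c := by
  induction k generalizing c with
  | zero => simpa using h c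
  | succ k ih =>
    simp only [jumpOp_pow_succ_apply]
    exact Finset.sum_le_sum fun j _ => mul_le_mul_of_nonneg_left (ih _) (hr j)

theorem jumpOp_pow_nonneg (k : ℕ) {f : S → ℝ} (h : ∀ c, 0 ≤ f c) (c : S) :
    0 ≤ (jumpOp r U ^ k) f c := by
  simpa using jumpOp_pow_mono hr U k (f := 0) h c

theorem jumpOp_pow_indicator_nonneg (k : ℕ) (c d : S) :
    0 ≤ (jumpOp r U ^ k) (Set.indicator {d} 1) c :=
  jumpOp_pow_nonneg hr U k (fun _ => Set.indicator_nonneg (by simp) _) c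

theorem jumpOp_pow_indicator_le (k : ℕ) (c d : S) :
    (jumpOp r U ^ k) (Set.indicator {d} 1) c ≤ (∑ j, r j) ^ k := by
  induction k generalizing c with
  | zero => simpa using Set.indicator_le_self' (s := {d}) (f := (1 : S → ℝ)) (by simp) c
  | succ k ih =>
    rw [jumpOp_pow_succ_apply, pow_succ', Finset.sum_mul]
    exact Finset.sum_le_sum fun j _ => mul_le_mul_of_nonneg_left (ih _) (hr j)

theorem summable_jumpOp_series (t : ℝ≥0) (c d : S) :
    Summable fun k : ℕ => (t : ℝ) ^ k / (k.factorial : ℝ) *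
      (jumpOp r U ^ k) (Set.indicator {d} 1) c := by
  refine Summable.of_nonneg_of_le
    (fun k => mul_nonneg (by positivity) (jumpOp_pow_indicator_nonneg hr U k c d)) (fun k => ?_)
    (Real.summable_pow_div_factorial (t * ∑ j, r j))
  rw [mul_pow, mul_div_right_comm]
  exact mul_le_mul_of_nonneg_left (jumpOp_pow_indicator_le hr U k c d) (by positivity)

/-- Uniformization: `exp (t L) = exp (-λ t) * exp (t Q)`. -/
theorem transProb_generator (t : ℝ≥0) (c d : S) :
    transProb (generator r U) t c d = Real.exp (-((∑ j, r j) * t)) *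
      ∑' k : ℕ, (t : ℝ) ^ k / (k.factorial : ℝ) *
        (jumpOp r U ^ k) (Set.indicator {d} 1) c := by
  rw [Real.exp_eq_exp_ℝ, NormedSpace.exp_eq_tsum_div]
  simp only
  rw [tsum_mul_tsum_eq_tsum_sum_antidiagonal_of_summable_norm
    (Real.summable_pow_div_factorial _).norm (summable_jumpOp_series hr U t c d).norm, transProb]
  refine tsum_congr fun k => ?_
  -- The scalar `-λ` commutes with `Q`, so the binomial theorem turns the `k`-th term into the
  -- `k`-th term of the Cauchy product of two exponential series.
  rw [generator_eq, (Algebra.commute_algebraMap_left (-∑ j, r j) (jumpOp r U)).add_pow',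
    LinearMap.sum_apply, Finset.sum_apply, Finset.mul_sum]
  refine Finset.sum_congr rfl fun p hp => ?_
  obtain ⟨a, b⟩ := p
  rw [Finset.HasAntidiagonal.mem_antidiagonal] at hp
  simp only at hp ⊢
  subst hp
  rw [← map_pow, LinearMap.smul_apply, Module.End.mul_apply, Module.algebraMap_end_apply]
  simp only [Pi.smul_apply, smul_eq_mul, nsmul_eq_mul]
  have h : ((a + b).choose a : ℝ) * a.factorial * b.factorial = (a + b).factorial := by
    rw [Nat.choose_symm_add]
    exact_mod_cast Nat.add_choose_mul_factorial_mul_factorial a b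
  have ha : (a.factorial : ℝ) ≠ 0 := by positivity
  have hb : (b.factorial : ℝ) ≠ 0 := by positivity
  rw [← h]
  have hc : ((a + b).choose a : ℝ) ≠ 0 := by
    exact_mod_cast (Nat.choose_pos (Nat.le_add_right a b)).ne'
  field_simp
  ring

theorem transProb_nonneg (t : ℝ≥0) (c d : S) : 0 ≤ transProb (generator r U) t c d := by
  rw [transProb_generator hr]
  exact mul_nonneg (Real.exp_nonneg _) (tsum_nonneg fun k =>
    mul_nonneg (by positivity) (jumpOp_pow_indicator_nonneg hr U k c d))

theorem ofReal_transProb (t : ℝ≥0) (c d : S) :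
    ENNReal.ofReal (transProb (generator r U) t c d) =
      ENNReal.ofReal (Real.exp (-((∑ j, r j) * t))) *
      ∑' k : ℕ, ENNReal.ofReal ((t : ℝ) ^ k / (k.factorial : ℝ)) *
        ENNReal.ofReal ((jumpOp r U ^ k) (Set.indicator {d} 1) c) := by
  rw [transProb_generator hr, ENNReal.ofReal_mul (Real.exp_nonneg _),
    ENNReal.ofReal_tsum_of_nonneg (fun k =>
      mul_nonneg (by positivity) (jumpOp_pow_indicator_nonneg hr U k c d))
      (summable_jumpOp_series hr U t c d)]
  congr 1
  exact tsum_congr fun k => ENNReal.ofReal_mul (by positivity)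

theorem ofReal_jumpOp_pow_succ (k : ℕ) (c d : S) :
    ENNReal.ofReal ((jumpOp r U ^ (k + 1)) (Set.indicator {d} 1) c) =
      ∑ j, ENNReal.ofReal (r j) *
        ENNReal.ofReal ((jumpOp r U ^ k) (Set.indicator {d} 1) (U j c)) := by
  rw [jumpOp_pow_succ_apply, ENNReal.ofReal_sum_of_nonneg fun j _ =>
    mul_nonneg (hr j) (jumpOp_pow_indicator_nonneg hr U k _ d)]
  exact Finset.sum_congr rfl fun j _ => ENNReal.ofReal_mul (hr j)

theorem exp_neg_mul_tsum_pow (t : ℝ≥0) :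
    ENNReal.ofReal (Real.exp (-((∑ j, r j) * t))) *
      ∑' k : ℕ, ENNReal.ofReal ((t : ℝ) ^ k / (k.factorial : ℝ)) *
        ENNReal.ofReal (∑ j, r j) ^ k = 1 := by
  have hl : 0 ≤ ∑ j, r j := Finset.sum_nonneg fun j _ => hr j
  have h : ∀ k : ℕ, ENNReal.ofReal ((t : ℝ) ^ k / (k.factorial : ℝ)) *
      ENNReal.ofReal (∑ j, r j) ^ k = ENNReal.ofReal (((∑ j, r j) * t) ^ k / k.factorial) := by
    intro k
    rw [← ENNReal.ofReal_pow hl, ← ENNReal.ofReal_mul (by positivity)]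
    congr 1
    ring
  simp_rw [h]
  rw [← ENNReal.ofReal_tsum_of_nonneg (fun k => by positivity)
    (Real.summable_pow_div_factorial _), ← ENNReal.ofReal_mul (Real.exp_nonneg _)]
  have := congrFun (NormedSpace.exp_eq_tsum_div (𝔸 := ℝ)) ((∑ j, r j) * t)
  rw [← this, ← Real.exp_eq_exp_ℝ, ← Real.exp_add]
  simp

theorem tsum_ofReal_jumpOp_pow (k : ℕ) (c : S) :
    ∑' d, ENNReal.ofReal ((jumpOp r U ^ k) (Set.indicator {d} 1) c) =
      ENNReal.ofReal (∑ j, r j) ^ k := by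
  induction k generalizing c with
  | zero =>
    rw [tsum_eq_single c fun d hd => by simp [hd.symm]]
    simp
  | succ k ih =>
    simp_rw [ofReal_jumpOp_pow_succ hr]
    rw [Summable.tsum_finsetSum fun _ _ => ENNReal.summable]
    simp_rw [ENNReal.tsum_mul_left, ih]
    rw [← Finset.sum_mul, ← ENNReal.ofReal_sum_of_nonneg fun j _ => hr j, pow_succ']

theorem tsum_ofReal_transProb (t : ℝ≥0) (c : S) :
    ∑' d, ENNReal.ofReal (transProb (generator r U) t c d) = 1 := by
  simp_rw [ofReal_transProb hr]
  rw [ENNReal.tsum_mul_left, ENNReal.tsum_comm]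
  simp_rw [ENNReal.tsum_mul_left, tsum_ofReal_jumpOp_pow hr]
  exact exp_neg_mul_tsum_pow hr t

/-- A distribution that satisfies the global balance equations is stationary. -/
theorem isStationary_of_balance (π : PMF S)
    (h : ∀ g : S → ℝ≥0∞, ∑' c, π c * ∑ j, ENNReal.ofReal (r j) * g (U j c) =
      ENNReal.ofReal (∑ j, r j) * ∑' c, π c * g c) :
    IsStationary (generator r U) π := by
  have hk : ∀ (k : ℕ) (d : S),
      ∑' c, π c * ENNReal.ofReal ((jumpOp r U ^ k) (Set.indicator {d} 1) c) =
        ENNReal.ofReal (∑ j, r j) ^ k * π d := by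
    intro k d
    induction k with
    | zero =>
      rw [tsum_eq_single d fun c hc => by simp [hc]]
      simp
    | succ k ih =>
      simp_rw [ofReal_jumpOp_pow_succ hr]
      rw [h fun c => ENNReal.ofReal ((jumpOp r U ^ k) (Set.indicator {d} 1) c), ih, pow_succ',
        mul_assoc]
  intro t d
  simp_rw [ofReal_transProb hr, mul_left_comm (π _), ENNReal.tsum_mul_left,
    ← ENNReal.tsum_mul_left (a := π _)]
  rw [ENNReal.tsum_comm]
  simp_rw [mul_left_comm (π _), ENNReal.tsum_mul_left, hk, ← mul_assoc]
  rw [ENNReal.tsum_mul_right, ← mul_assoc, exp_neg_mul_tsum_pow hr, one_mul]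

end JumpOperator

/-! ### Doeblin minorization, irreducibility and uniqueness -/

section Doeblin

variable {S ι : Type*} [Fintype ι]

/-- Some power of the jump operator leads to `d` from all states, with weights bounded below. -/
def IsUniformlyAccessible (r : ι → ℝ) (U : ι → S → S) (d : S) : Prop :=
  ∃ (N : ℕ) (ε : ℝ), 0 < ε ∧ ∀ c, ε ≤ (jumpOp r U ^ N) (Set.indicator {d} 1) c

variable {r : ι → ℝ} (hr : ∀ j, 0 ≤ r j) {U : ι → S → S}

include hr

theorem pow_mul_iterate_le_jumpOp_pow (j : ι) (k : ℕ) {f : S → ℝ} (hf : ∀ c, 0 ≤ f c) (c : S) :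
    r j ^ k * f ((U j)^[k] c) ≤ (jumpOp r U ^ k) f c := by
  induction k generalizing c with
  | zero => simp
  | succ k ih =>
    rw [jumpOp_pow_succ_apply, pow_succ', mul_assoc, Function.iterate_succ_apply]
    exact (mul_le_mul_of_nonneg_left (ih _) (hr j)).trans
      (Finset.single_le_sum (f := fun j => r j * (jumpOp r U ^ k) f (U j c))
        (fun i _ => mul_nonneg (hr i) (jumpOp_pow_nonneg hr U k hf _)) (Finset.mem_univ j))

theorem isUniformlyAccessible_of_iterate {j : ι} (hj : 0 < r j) (k : ℕ) {d : S}
    (h : ∀ c, (U j)^[k] c = d) : IsUniformlyAccessible r U d := by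
  refine ⟨k, r j ^ k, pow_pos hj k, fun c => ?_⟩
  simpa [h c] using pow_mul_iterate_le_jumpOp_pow hr (U := U) j k (f := Set.indicator {d} 1)
    (fun _ => Set.indicator_nonneg (by simp) _) c

theorem IsUniformlyAccessible.map {d : S} (hd : IsUniformlyAccessible r U d) {j : ι}
    (hj : 0 < r j) : IsUniformlyAccessible r U (U j d) := by
  obtain ⟨N, ε, hε, h⟩ := hd
  refine ⟨N + 1, r j * ε, mul_pos hj hε, fun c => ?_⟩
  -- The last jump is split off, not the first: it is the innermost `Q`, and `Q 1_{U j d} ≥ r j •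
  -- 1_d`.
  rw [pow_succ, Module.End.mul_apply]
  calc r j * ε ≤ r j * (jumpOp r U ^ N) (Set.indicator {d} 1) c :=
        mul_le_mul_of_nonneg_left (h c) hj.le
    _ = (jumpOp r U ^ N) (r j • Set.indicator {d} 1) c := by
        rw [map_smul, Pi.smul_apply, smul_eq_mul]
    _ ≤ _ := by
        refine jumpOp_pow_mono hr U N (fun c => ?_) c
        have h0 : ∀ i, 0 ≤ r i * Set.indicator {U j d} (1 : S → ℝ) (U i c) := fun i =>
          mul_nonneg (hr i) (Set.indicator_nonneg (by simp) _)
        by_cases hc : c = d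
        · subst hc
          refine le_trans (le_of_eq ?_) (Finset.single_le_sum (fun i _ => h0 i)
            (Finset.mem_univ j))
          simp
        · simpa [hc, jumpOp_apply] using Finset.sum_nonneg fun i _ => h0 i

theorem IsUniformlyAccessible.exists_le_transProb {d : S} (hd : IsUniformlyAccessible r U d) :
    ∃ δ : ℝ, 0 < δ ∧ ∀ c, δ ≤ transProb (generator r U) 1 c d := by
  obtain ⟨N, ε, hε, h⟩ := hd
  refine ⟨Real.exp (-((∑ j, r j) * (1 : ℝ≥0))) *
    (((1 : ℝ≥0) : ℝ) ^ N / (N.factorial : ℝ) * ε), by positivity, fun c => ?_⟩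
  rw [transProb_generator hr]
  refine mul_le_mul_of_nonneg_left ?_ (Real.exp_nonneg _)
  refine le_trans ?_ ((summable_jumpOp_series hr U 1 c d).le_tsum N fun k _ =>
    mul_nonneg (by positivity) (jumpOp_pow_indicator_nonneg hr U k c d))
  exact mul_le_mul_of_nonneg_left (h c) (by positivity)

theorem isIrreducible_of_isUniformlyAccessible (h : ∀ d, IsUniformlyAccessible r U d) :
    IsIrreducible (generator r U) := fun c d => by
  obtain ⟨δ, hδ, hle⟩ := (h d).exists_le_transProb hr
  exact ⟨1, hδ.trans_le (hle c)⟩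

/-- The minimum `m` of two stationary laws satisfies `m P ≤ m`, and `P` preserves total mass, so `m
P = m`. At `d` one of the two laws, say `p`, equals `m`; then `p - m` is a nonnegative invariant
measure vanishing at `d`. As `P(c, d) > 0` for all `c`, it is zero, so `p` lies below the other law,
and two probability measures so ordered coincide. -/
theorem stationary_unique_of_isUniformlyAccessible {d : S} (hd : IsUniformlyAccessible r U d)
    {π π' : PMF S} (hπ : IsStationary (generator r U) π)
    (hπ' : IsStationary (generator r U) π') : π' = π := by
  obtain ⟨δ, hδ, hle⟩ := hd.exists_le_transProb hr
  set P : S → S → ℝ≥0∞ := fun c e => ENNReal.ofReal (transProb (generator r U) 1 c e)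
  have eq_of_le : ∀ p q : PMF S, (∀ c, p c ≤ q c) → p = q := by
    intro p q h
    ext c
    by_contra hne
    have := ENNReal.tsum_lt_tsum p.tsum_coe_ne_top h (lt_of_le_of_ne (h c) hne)
    simp [PMF.tsum_coe] at this
  set m : S → ℝ≥0∞ := fun c => min (π c) (π' c)
  have hm_ne : ∀ c, m c ≠ ⊤ := fun c => ne_top_of_le_ne_top (π.apply_ne_top c) (min_le_left _ _)
  have hm_le : ∀ e, ∑' c, m c * P c e ≤ m e := fun e => le_min
    ((ENNReal.tsum_le_tsum fun c => mul_le_mul_left (min_le_left _ _) _).trans (hπ 1 e).le)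
    ((ENNReal.tsum_le_tsum fun c => mul_le_mul_left (min_le_right _ _) _).trans (hπ' 1 e).le)
  have hsum : ∑' e, ∑' c, m c * P c e = ∑' e, m e := by
    rw [ENNReal.tsum_comm]
    simp_rw [ENNReal.tsum_mul_left, P, tsum_ofReal_transProb hr, mul_one]
  have hfin : ∑' e, m e ≠ ⊤ := ne_top_of_le_ne_top π.tsum_coe_ne_top
    (ENNReal.tsum_le_tsum fun c => min_le_left _ _)
  have hm : ∀ e, ∑' c, m c * P c e = m e := by
    intro e
    by_contra hne
    exact (ENNReal.tsum_lt_tsum (hsum ▸ hfin) hm_le (lt_of_le_of_ne (hm_le e) hne)).ne hsum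
  have key : ∀ p : PMF S, IsStationary (generator r U) p → (∀ c, m c ≤ p c) → p d = m d →
      ∀ c, p c = m c := by
    intro p hp hmp hpd c
    have h1 : ∑' c, m c * P c d + ∑' c, (p c - m c) * P c d = m d + 0 := by
      rw [← ENNReal.tsum_add, add_zero, ← hpd, ← hp 1 d]
      refine tsum_congr fun c => ?_
      rw [← add_mul, add_tsub_cancel_of_le (hmp c)]
    rw [hm d, ENNReal.add_right_inj (hm_ne d), ENNReal.tsum_eq_zero] at h1
    have h2 := (mul_eq_zero.1 (h1 c)).resolve_right
      (ENNReal.ofReal_pos.2 (hδ.trans_le (hle c))).ne'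
    exact le_antisymm (tsub_eq_zero_iff_le.1 h2) (hmp c)
  rcases le_total (π d) (π' d) with h | h
  · refine (eq_of_le π π' fun c => ?_).symm
    rw [key π hπ (fun c => min_le_left _ _) (min_eq_left h).symm c]
    exact min_le_right _ _
  · refine eq_of_le π' π fun c => ?_
    rw [key π' hπ' (fun c => min_le_right _ _) (min_eq_right h).symm c]
    exact min_le_left _ _

end Doeblin

/-! ### Positive recurrence from the chain at integer times -/

section Skeleton

variable {S : Type*} [MeasurableSpace S] [MeasurableSingletonClass S]
  {L : (S → ℝ) →ₗ[ℝ] (S → ℝ)} {c₀ : S}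
  {Ω : Type*} [MeasurableSpace Ω] {μ : Measure Ω} {Z : ℝ≥0 → Ω → S}

theorem IsMarkovChain.measure_initial_ne (h : IsMarkovChain L c₀ μ Z) : μ {ω | Z 0 ω ≠ c₀} = 0 := by
  have := h.isProbabilityMeasure
  have h1 : μ {ω | Z 0 ω = c₀} = 1 := by
    simpa using h.law 0 0 (fun _ => c₀) rfl
  exact (prob_compl_eq_zero_iff (h.measurable 0 (measurableSet_singleton c₀))).2 h1

theorem IsMarkovChain.measure_history_succ (h : IsMarkovChain L c₀ μ Z)
    (hL : ∀ c d, 0 ≤ transProb L 1 c d) (m : ℕ) (s : ℕ → S) :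
    μ {ω | ∀ i ≤ m + 1, Z i ω = s i} =
      μ {ω | ∀ i ≤ m, Z i ω = s i} * ENNReal.ofReal (transProb L 1 (s m) (s (m + 1))) := by
  by_cases hs : s 0 = c₀
  · have key := fun m => h.law m (fun _ => 1) s hs
    simp only [Finset.sum_const, Finset.card_range, nsmul_eq_mul, mul_one] at key
    rw [key, key, Finset.prod_range_succ, ENNReal.ofReal_mul (Finset.prod_nonneg fun _ _ => hL _ _)]
  · have key : ∀ m : ℕ, μ {ω | ∀ i ≤ m, Z i ω = s i} = 0 := fun m =>
      measure_mono_null (fun ω hω => by simpa [← hω 0 (Nat.zero_le m)] using hs)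
        h.measure_initial_ne
    rw [key, key, zero_mul]

/-- An event determined by the path at times `0, …, m` is a countable disjoint union of histories,
and each history continues to `d` with probability at least `δ`. -/
theorem IsMarkovChain.mul_measure_le [Countable S] (h : IsMarkovChain L c₀ μ Z)
    (hL : ∀ c d, 0 ≤ transProb L 1 c d) {d : S} {δ : ℝ} (hδ : ∀ c, δ ≤ transProb L 1 c d)
    {m : ℕ} {E : Set Ω} (hE : ∀ ω ω', (∀ i ≤ m, Z i ω = Z i ω') → ω ∈ E → ω' ∈ E) :
    ENNReal.ofReal δ * μ E ≤ μ (E ∩ {ω | Z (m + 1 : ℕ) ω = d}) := by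
  set hist : Ω → Fin (m + 1) → S := fun ω i => Z (i : ℕ) ω with hhist
  have hmeas : Measurable hist := measurable_pi_lambda _ fun i => h.measurable _
  set B := hist '' E
  have hEB : E = hist ⁻¹' B := by
    refine Set.Subset.antisymm (Set.subset_preimage_image _ _) ?_
    rintro ω ⟨ω', hω', heq⟩
    exact hE ω' ω (fun i hi => congrFun heq ⟨i, Nat.lt_succ_of_le hi⟩) hω'
  have hd : MeasurableSet {ω | Z (m + 1 : ℕ) ω = d} :=
    h.measurable _ (measurableSet_singleton d)
  have hB : MeasurableSet B := B.to_countable.measurableSet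
  rw [hEB, ← Measure.restrict_apply (hmeas hB), ← Measure.map_apply hmeas hB,
    ← Measure.map_apply hmeas hB, ← Measure.tsum_indicator_apply_singleton _ _ hB,
    ← Measure.tsum_indicator_apply_singleton _ _ hB, ← ENNReal.tsum_mul_left]
  refine ENNReal.tsum_le_tsum fun b => ?_
  by_cases hb : b ∈ B
  swap
  · simp [hb]
  simp only [hb, Set.indicator_of_mem]
  have hsb : MeasurableSet ({b} : Set (Fin (m + 1) → S)) := measurableSet_singleton b
  rw [Measure.map_apply hmeas hsb, Measure.map_apply hmeas hsb,
    Measure.restrict_apply (hmeas hsb)]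
  set s : ℕ → S := fun i => if hi : i < m + 1 then b ⟨i, hi⟩ else d with hs
  have h1 : hist ⁻¹' {b} = {ω | ∀ i ≤ m, Z i ω = s i} := by
    ext ω
    simp only [Set.mem_preimage, Set.mem_singleton_iff, funext_iff, Set.mem_ofPred_eq, hhist, hs]
    exact ⟨fun hω i hi => by simpa [Nat.lt_succ_of_le hi] using hω ⟨i, Nat.lt_succ_of_le hi⟩,
      fun hω i => by simpa [i.isLt] using hω i (Nat.le_of_lt_succ i.isLt)⟩
  have hsd : s (m + 1) = d := by simp [hs]
  have h2 : hist ⁻¹' {b} ∩ {ω | Z (m + 1 : ℕ) ω = d} = {ω | ∀ i ≤ m + 1, Z i ω = s i} := by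
    ext ω
    simp only [h1, Set.mem_inter_iff, Set.mem_ofPred_eq]
    constructor
    · rintro ⟨ha, hb⟩ i hi
      rcases Nat.le_succ_iff.1 hi with hi | rfl
      · exact ha i hi
      · rw [hsd, ← hb]
    · exact fun ha => ⟨fun i hi => ha i (by omega), by rw [ha _ le_rfl, hsd]⟩
  rw [h2, h.measure_history_succ hL, h1, hsd, mul_comm]
  exact mul_le_mul_right (ENNReal.ofReal_le_ofReal (hδ _)) _

theorem returnTime_le_of_visits {S : Type*} {z : ℝ≥0 → S} {c : S} {s t : ℝ≥0} (hst : s ≤ t)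
    (hs : z s ≠ c) (ht : z t = c) : returnTime z c ≤ t :=
  iInf_le_of_le t (iInf₂_le_of_le
    ((iInf₂_le s hs).trans (ENNReal.coe_le_coe.2 hst)) ht le_rfl)

/-- Fix `d ≠ c`. Whatever the history up to time `2k`, with probability at least `ε` the chain is at
`d` at time `2k + 1` and at `c` at time `2k + 2`; the visit to `d` ensures that `c` has been left.
The first successful block therefore has a geometric tail, and the mean return time is at most `∑ 2
(1 - ε)^k`. -/
theorem isPositiveRecurrent_of_minorization [Countable S] [Nontrivial S]
    (hL : ∀ c d, 0 ≤ transProb L 1 c d)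
    (h : ∀ d, ∃ δ : ℝ, 0 < δ ∧ ∀ c, δ ≤ transProb L 1 c d) : IsPositiveRecurrent L := by
  intro c Ω _ μ Z hZ
  have := hZ.isProbabilityMeasure
  obtain ⟨d, hdc⟩ := exists_ne c
  obtain ⟨a, ha, had⟩ := h d
  obtain ⟨b, hb, hbc⟩ := h c
  set N : ℕ → Set Ω := fun k =>
    {ω | ∀ i < k, ¬ (Z (2 * i + 1 : ℕ) ω = d ∧ Z (2 * i + 2 : ℕ) ω = c)} with hN
  set B : ℕ → Set Ω := fun k => {ω | Z (2 * k + 1 : ℕ) ω = d ∧ Z (2 * k + 2 : ℕ) ω = c} with hB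
  have hBm : ∀ k, MeasurableSet (B k) := fun k =>
    (hZ.measurable _ (measurableSet_singleton d)).inter
      (hZ.measurable _ (measurableSet_singleton c))
  have hNsucc : ∀ k, N (k + 1) = N k \ B k := fun k => by
    ext ω
    simp only [hN, hB, Set.mem_ofPred_eq, Set.mem_sdiff, Nat.lt_succ_iff_lt_or_eq, or_imp,
      forall_and, forall_eq]
  have hNm : ∀ k, MeasurableSet (N k) := fun k => by
    induction k with
    | zero => simp [hN]
    | succ k ih => rw [hNsucc]; exact ih.diff (hBm k)
  set ε : ℝ≥0∞ := ENNReal.ofReal b * ENNReal.ofReal a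
  have hε : 0 < ε := ENNReal.mul_pos (ENNReal.ofReal_pos.2 hb).ne' (ENNReal.ofReal_pos.2 ha).ne'
  have hNdep : ∀ k ω ω', (∀ i ≤ 2 * k, Z (i : ℕ) ω = Z (i : ℕ) ω') → ω ∈ N k → ω' ∈ N k := by
    intro k ω ω' hω hmem i hi
    rw [← hω (2 * i + 1) (by omega), ← hω (2 * i + 2) (by omega)]
    exact hmem i hi
  have hstep : ∀ k, ε * μ (N k) ≤ μ (N k ∩ B k) := by
    intro k
    have h1 := hZ.mul_measure_le hL had (hNdep k)
    have h2 := hZ.mul_measure_le hL hbc (m := 2 * k + 1)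
      (E := N k ∩ {ω | Z (2 * k + 1 : ℕ) ω = d}) (by
        rintro ω ω' hω ⟨hm, hd⟩
        refine ⟨hNdep k ω ω' (fun i hi => hω i (by omega)) hm, ?_⟩
        rw [Set.mem_ofPred_eq, ← hω _ le_rfl]
        exact hd)
    rw [Set.inter_assoc] at h2
    rw [mul_assoc]
    exact (mul_le_mul_right h1 _).trans h2
  have hgeom : ∀ k, μ (N k) ≤ (1 - ε) ^ k := by
    intro k
    induction k with
    | zero => simpa using prob_le_one
    | succ k ih =>
      have hε_le : ε * μ (N k) ≠ ⊤ :=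
        ENNReal.mul_ne_top (ENNReal.mul_ne_top ENNReal.ofReal_ne_top ENNReal.ofReal_ne_top)
          (measure_ne_top _ _)
      refine le_trans ?_ ((mul_le_mul_right ih _).trans_eq (pow_succ' _ _).symm)
      rw [hNsucc, ENNReal.sub_mul fun _ _ => measure_ne_top _ _, one_mul]
      refine ENNReal.le_sub_of_add_le_right hε_le ?_
      exact (add_le_add_right (hstep k) _).trans_eq (measure_sdiff_add_inter _ (hBm k))
  have hret : ∀ ω, returnTime (fun t => Z t ω) c ≤ ∑' k, (N k).indicator (fun _ => 2) ω := by
    intro ω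
    by_cases hex : ∃ k, ω ∈ B k
    · classical
      set K := Nat.find hex
      have hK : ω ∈ B K := Nat.find_spec hex
      have hle : returnTime (fun t => Z t ω) c ≤ ((2 * K + 2 : ℕ) : ℝ≥0) :=
        returnTime_le_of_visits (s := (2 * K + 1 : ℕ)) (by exact_mod_cast Nat.le_succ _)
          (by rw [hK.1]; exact hdc) hK.2
      refine hle.trans (le_trans (le_of_eq ?_) (ENNReal.sum_le_tsum (Finset.range (K + 1))))
      rw [Finset.sum_congr rfl fun k hk => Set.indicator_of_mem (s := N k) (f := fun _ => 2)
        (a := ω) fun i hi => Nat.find_min hex (by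
          have := Finset.mem_range.1 hk
          omega)]
      simp
      ring
    · have : ∀ k, (N k).indicator (fun _ => (2 : ℝ≥0∞)) ω = 2 := fun k =>
        Set.indicator_of_mem (s := N k) (fun i _ hi => hex ⟨i, hi⟩) _
      simp [this]
  calc ∫⁻ ω, returnTime (fun t => Z t ω) c ∂μ
      ≤ ∫⁻ ω, ∑' k, (N k).indicator (fun _ => 2) ω ∂μ := lintegral_mono hret
    _ = ∑' k, 2 * μ (N k) := by
      rw [lintegral_tsum fun k => (measurable_const.indicator (hNm k)).aemeasurable]
      simp_rw [lintegral_indicator_const (hNm _)]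
    _ ≤ ∑' k, 2 * (1 - ε) ^ k := ENNReal.tsum_le_tsum fun k => mul_le_mul_right (hgeom k) _
    _ < ⊤ := by
      rw [ENNReal.tsum_mul_left, ENNReal.tsum_geometric]
      refine ENNReal.mul_lt_top (by simp) (ENNReal.inv_lt_top.2 ?_)
      exact tsub_pos_of_lt (ENNReal.sub_lt_self (by simp) (by simp) hε.ne')

end Skeleton

/-! ### The numbers of balls between two shifts -/

section GeomMultinomial

/-- The probability that `D i` balls are added to bin `i`, for `i : Fin k`, in the time between two
consecutive shifts: the multinomial distribution whose size is geometric. -/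
noncomputable def geomMultinomial (r : ℕ → ℝ≥0) (k : ℕ) (D : Fin k → ℕ) : ℝ≥0 :=
  r 0 * Nat.multinomial Finset.univ D * (∏ i : Fin k, r (i.val + 1) ^ D i) /
    (∑ i ∈ Finset.range (k + 1), r i) ^ (∑ i, D i + 1)

variable {r : ℕ → ℝ≥0} (hr0 : r 0 ≠ 0)
include hr0

theorem sum_range_succ_rate_ne_zero (k : ℕ) : ∑ i ∈ Finset.range (k + 1), r i ≠ 0 := by
  rw [Finset.sum_range_succ']
  exact fun h => hr0 (add_eq_zero.1 h).2

theorem geomMultinomial_zero (D : Fin 0 → ℕ) : geomMultinomial r 0 D = 1 := by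
  simp [geomMultinomial, hr0]

omit hr0 in
theorem multinomial_snoc {k : ℕ} (D : Fin k → ℕ) (a : ℕ) :
    Nat.multinomial Finset.univ (Fin.snoc D a : Fin (k + 1) → ℕ) =
      (∑ i, D i + a).choose a * Nat.multinomial Finset.univ D := by
  have h1 := Nat.multinomial_spec Finset.univ (Fin.snoc D a : Fin (k + 1) → ℕ)
  have h2 := Nat.multinomial_spec Finset.univ D
  rw [Fin.prod_univ_castSucc, Fin.sum_univ_castSucc] at h1
  simp only [Fin.snoc_castSucc, Fin.snoc_last] at h1
  have h3 := Nat.add_choose_mul_factorial_mul_factorial (∑ i, D i) a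
  have h4 : (∏ i, (D i).factorial) * a.factorial ≠ 0 :=
    mul_ne_zero (Finset.prod_ne_zero_iff.2 fun i _ => Nat.factorial_ne_zero _)
      (Nat.factorial_ne_zero _)
  apply mul_left_cancel₀ h4
  rw [h1, ← h3, ← h2]
  ring

/-- Negative binomial series: `∑ (a + m).choose m * q ^ a = (1 - q)⁻¹ ^ (m + 1)` with `q = z / (y +
z)`, so that `1 - q = y / (y + z)`. -/
theorem tsum_geomMultinomial_snoc (k : ℕ) (D : Fin k → ℕ) :
    ∑' a, (geomMultinomial r (k + 1) (Fin.snoc D a) : ℝ≥0∞) = geomMultinomial r k D := by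
  set y : ℝ≥0 := ∑ i ∈ Finset.range (k + 1), r i with hy
  set z : ℝ≥0 := r (k + 1)
  have hy0 : y ≠ 0 := sum_range_succ_rate_ne_zero hr0 k
  have hyz : y + z ≠ 0 := fun h => hy0 (add_eq_zero.1 h).1
  set m := ∑ i, D i with hm
  set C : ℝ≥0 := r 0 * Nat.multinomial Finset.univ D * (∏ i : Fin k, r (i.val + 1) ^ D i)
  have hterm : ∀ a, geomMultinomial r (k + 1) (Fin.snoc D a) =
      C / (y + z) ^ (m + 1) * ((a + m).choose m * (z / (y + z)) ^ a) := by
    intro a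
    rw [geomMultinomial, Finset.sum_range_succ _ (k + 1), multinomial_snoc, Fin.prod_univ_castSucc,
      Fin.sum_univ_castSucc]
    simp only [Fin.snoc_castSucc, Fin.snoc_last, Fin.val_castSucc, Fin.val_last, ← hm, ← hy]
    rw [add_comm m a, Nat.choose_symm_add]
    push_cast
    simp only [C, z]
    rw [div_pow]
    field_simp
    ring
  have hlt : ‖((z / (y + z) : ℝ≥0) : ℝ)‖ < 1 := by
    rw [Real.norm_of_nonneg (NNReal.coe_nonneg _)]
    rw [← NNReal.coe_one, NNReal.coe_lt_coe, div_lt_one (pos_iff_ne_zero.2 hyz)]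
    exact lt_add_of_pos_left _ (pos_iff_ne_zero.2 hy0)
  have hs := (hasSum_choose_mul_geometric_of_norm_lt_one m hlt).mul_left
    ((C / (y + z) ^ (m + 1) : ℝ≥0) : ℝ)
  have hval : ((C / (y + z) ^ (m + 1) : ℝ≥0) : ℝ) *
      (1 / (1 - ((z / (y + z) : ℝ≥0) : ℝ)) ^ (m + 1)) = (geomMultinomial r k D : ℝ≥0) := by
    have h1 : (1 : ℝ) - ((z / (y + z) : ℝ≥0) : ℝ) = y / (y + z) := by
      have : (y : ℝ) + z ≠ 0 := by exact_mod_cast hyz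
      push_cast
      field_simp
      ring
    have h2 : (y : ℝ) ≠ 0 := by exact_mod_cast hy0
    have h3 : (y : ℝ) + z ≠ 0 := by exact_mod_cast hyz
    rw [h1, geomMultinomial, ← hm, ← hy]
    push_cast
    rw [div_pow]
    field_simp
    simp [C]
  rw [hval] at hs
  have hs' : HasSum (fun a => geomMultinomial r (k + 1) (Fin.snoc D a))
      (geomMultinomial r k D) := by
    rw [← NNReal.hasSum_coe]
    refine hs.congr_fun fun a => ?_
    rw [hterm]
    push_cast
    ring
  exact (ENNReal.hasSum_coe.2 hs').tsum_eq

/-- The marginal of `geomMultinomial r (k + 1)` on the first `k` coordinates. -/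
theorem tsum_geomMultinomial_mul_init (k : ℕ) (g : (Fin k → ℕ) → ℝ≥0∞) :
    ∑' D, (geomMultinomial r (k + 1) D : ℝ≥0∞) * g (Fin.init D) =
      ∑' D, (geomMultinomial r k D : ℝ≥0∞) * g D := by
  rw [← (Fin.snocEquiv fun _ : Fin (k + 1) => ℕ).tsum_eq, ENNReal.tsum_prod', ENNReal.tsum_comm]
  refine tsum_congr fun D => ?_
  simp only [Fin.snocEquiv, Equiv.coe_fn_mk, Fin.init_snoc]
  rw [ENNReal.tsum_mul_right, tsum_geomMultinomial_snoc hr0]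

theorem tsum_geomMultinomial (k : ℕ) : ∑' D, (geomMultinomial r k D : ℝ≥0∞) = 1 := by
  induction k with
  | zero => simp [tsum_fintype, geomMultinomial_zero hr0]
  | succ k ih => simpa [ih] using tsum_geomMultinomial_mul_init hr0 k (fun _ => 1)

/-- The flow from `D` to `D' = D + e_j` is the fraction `D' j / ∑ i, D' i` of the total outflow of
`D'`: by exchangeability, this is the probability that the last ball inserted went to bin `j`. -/
theorem rate_mul_geomMultinomial (k : ℕ) (D : Fin k → ℕ) (j : Fin k) :
    r (j.val + 1) * geomMultinomial r k D =
      (∑ i ∈ Finset.range (k + 1), r i) * (geomMultinomial r k (D + Pi.single j 1) *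
        (((D + Pi.single j 1 : Fin k → ℕ) j : ℕ) / (∑ i, (D + Pi.single j 1 : Fin k → ℕ) i : ℕ))) := by
  have hy0 := sum_range_succ_rate_ne_zero hr0 k
  have hsum : ∑ i, (D + Pi.single j 1 : Fin k → ℕ) i = ∑ i, D i + 1 := by
    simp [Finset.sum_add_distrib]
  have hmult : (D j + 1) * Nat.multinomial Finset.univ (D + Pi.single j 1) =
      (∑ i, D i + 1) * Nat.multinomial Finset.univ D := by
    have h1 := Nat.multinomial_spec Finset.univ (D + Pi.single j 1)
    have h2 := Nat.multinomial_spec Finset.univ D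
    rw [hsum] at h1
    have h3 : ∏ i, ((D + Pi.single j 1 : Fin k → ℕ) i).factorial =
        (D j + 1) * ∏ i, (D i).factorial := by
      rw [← Finset.mul_prod_erase _ _ (Finset.mem_univ j),
        ← Finset.mul_prod_erase _ (fun i => (D i).factorial) (Finset.mem_univ j), ← mul_assoc]
      congr 1
      · simp [Nat.factorial_succ]
      · exact Finset.prod_congr rfl fun i hi => by simp [Finset.ne_of_mem_erase hi]
    have h4 : ∏ i, (D i).factorial ≠ 0 := Finset.prod_ne_zero_iff.2 fun i _ =>
      Nat.factorial_ne_zero _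
    apply mul_left_cancel₀ h4
    rw [Nat.factorial_succ, ← h2, h3] at h1
    linarith
  have hprod : ∏ i : Fin k, r (i.val + 1) ^ (D + Pi.single j 1 : Fin k → ℕ) i =
      r (j.val + 1) * ∏ i : Fin k, r (i.val + 1) ^ D i := by
    simp only [Pi.add_apply, pow_add, Finset.prod_mul_distrib]
    rw [mul_comm]
    congr 1
    rw [Finset.prod_eq_single j] <;> simp +contextual
  have hmult' : (Nat.multinomial Finset.univ (D + Pi.single j 1) : ℝ≥0) * ((D j : ℝ≥0) + 1) =
      ((∑ i, D i : ℕ) + 1) * Nat.multinomial Finset.univ D := by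
    rw [mul_comm]
    exact_mod_cast hmult
  rw [geomMultinomial, geomMultinomial, hsum, hprod]
  set y := ∑ i ∈ Finset.range (k + 1), r i
  have h5 : ((∑ i, D i : ℕ) + 1 : ℝ≥0) ≠ 0 := by positivity
  have h6 : (((D + Pi.single j 1 : Fin k → ℕ) j : ℕ) : ℝ≥0) = D j + 1 := by simp
  rw [h6, Nat.cast_succ]
  calc _ = r (j.val + 1) * r 0 * (∏ i : Fin k, r (i.val + 1) ^ D i) / y ^ (∑ i, D i + 1) *
      ((((∑ i, D i : ℕ) + 1) * Nat.multinomial Finset.univ D) / ((∑ i, D i : ℕ) + 1)) := by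
        rw [mul_div_cancel_left₀ _ h5]
        ring
    _ = _ := by
        rw [← hmult', pow_succ _ (_ + 1)]
        field_simp

theorem geomMultinomial_apply_zero (k : ℕ) :
    (∑ i ∈ Finset.range (k + 1), r i) * geomMultinomial r k 0 = r 0 := by
  have hy0 := sum_range_succ_rate_ne_zero hr0 k
  have : Nat.multinomial Finset.univ (0 : Fin k → ℕ) = 1 := by simp [Nat.multinomial]
  rw [geomMultinomial, this]
  simp [mul_div_cancel₀, hy0]

/-- The balance equation of the chain that adds balls at the rates `r (j + 1)` and removes all balls
at the rate `r 0`. -/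
theorem tsum_geomMultinomial_balance (k : ℕ) (g : (Fin k → ℕ) → ℝ≥0∞) :
    (r 0 : ℝ≥0∞) * g 0 + ∑ j : Fin k, (r (j.val + 1) : ℝ≥0∞) *
        ∑' D, (geomMultinomial r k D : ℝ≥0∞) * g (D + Pi.single j 1) =
      (∑ i ∈ Finset.range (k + 1), r i : ℝ≥0) *
        ∑' D, (geomMultinomial r k D : ℝ≥0∞) * g D := by
  set y := ∑ i ∈ Finset.range (k + 1), r i with hy
  have hj : ∀ j : Fin k, (r (j.val + 1) : ℝ≥0∞) *
        ∑' D, (geomMultinomial r k D : ℝ≥0∞) * g (D + Pi.single j 1) =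
      ∑' D, (y : ℝ≥0∞) * ((geomMultinomial r k D * ((D j : ℕ) / (∑ i, D i : ℕ)) : ℝ≥0) * g D) := by
    intro j
    rw [← ENNReal.tsum_mul_left]
    have hinj : Function.Injective fun D : Fin k → ℕ => D + Pi.single j 1 :=
      add_left_injective _
    rw [← hinj.tsum_eq (f := fun D => (y : ℝ≥0∞) *
      ((geomMultinomial r k D * ((D j : ℕ) / (∑ i, D i : ℕ)) : ℝ≥0) * g D))]
    · refine tsum_congr fun D => ?_
      rw [← mul_assoc, ← mul_assoc, ← ENNReal.coe_mul, ← ENNReal.coe_mul,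
        rate_mul_geomMultinomial hr0]
    -- Points outside the range of `D ↦ D + e_j` have `D j = 0` and contribute nothing.
    · intro D hD
      refine ⟨D - Pi.single j 1, ?_⟩
      have : D j ≠ 0 := fun h => hD (by simp [h])
      funext i
      by_cases hi : i = j
      · subst hi
        simp
        omega
      · simp [hi]
  simp_rw [hj]
  rw [← Summable.tsum_finsetSum fun _ _ => ENNReal.summable, ← ENNReal.tsum_mul_left,
    ENNReal.tsum_eq_add_tsum_ite 0,
    ENNReal.tsum_eq_add_tsum_ite (f := fun D => (y : ℝ≥0∞) * (_ * g D)) 0]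
  -- At `D = 0` the fractions are `0 / 0 = 0`, and the reset term supplies the whole mass; for `D ≠
  -- 0` they sum to `1` over `j`.
  rw [← geomMultinomial_apply_zero hr0 k]
  simp only [Pi.zero_apply, Nat.cast_zero, zero_div, mul_zero, ENNReal.coe_zero, zero_mul,
    Finset.sum_const_zero, zero_add]
  rw [ENNReal.coe_mul, mul_assoc]
  congr 1
  refine tsum_congr fun D => ?_
  split_ifs with h
  · rfl
  rw [← Finset.mul_sum, ← Finset.sum_mul, ← ENNReal.ofNNReal_finsetSum, ← Finset.mul_sum,
    ← Finset.sum_div, ← Nat.cast_sum, div_self, mul_one]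
  intro h0
  apply h
  funext i
  have := Nat.cast_eq_zero.1 h0
  exact Finset.sum_eq_zero_iff.1 this i (Finset.mem_univ i)

end GeomMultinomial

/-! ### Splitting off the longest diagonal of a triangular array -/

namespace TriArray

variable {n : ℕ}

/-- The array whose longest diagonal is `D` and whose other diagonals are those of `B`. -/
def extend (D : Fin (n + 1) → ℕ) (B : TriArray n) : TriArray (n + 1) := fun k =>
  Fin.lastCases (motive := fun _ => ℕ) (D k)
    (Fin.cases (motive := fun k : Fin (n + 1) => Fin k.val → ℕ) Fin.elim0 (fun k => B k) k)

theorem extend_last (D : Fin (n + 1) → ℕ) (B : TriArray n) (k : Fin (n + 1)) :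
    extend D B k (Fin.last _) = D k := by
  simp [extend]

theorem extend_castSucc (D : Fin (n + 1) → ℕ) (B : TriArray n) (k : Fin n)
    (j : Fin (k.val + 1)) : extend D B k.succ j.castSucc = B k j := by
  simp only [extend, Fin.val_succ]
  exact Fin.lastCases_castSucc (motive := fun _ => ℕ) (i := j)

/-- A triangular array is given by its longest diagonal and the array of the other diagonals. -/
def extendEquiv (n : ℕ) : (Fin (n + 1) → ℕ) × TriArray n ≃ TriArray (n + 1) where
  toFun p := extend p.1 p.2
  invFun A := (fun k => A k (Fin.last _), fun k j => A k.succ j.castSucc)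
  left_inv p := by
    refine Prod.ext (funext fun k => extend_last _ _ _) (funext fun k => funext fun j => ?_)
    exact extend_castSucc _ _ _ _
  right_inv A := by
    funext k
    refine Fin.cases (motive := fun k => extend _ _ k = A k) ?_ (fun k => ?_) k
    · funext j
      rw [Fin.eq_zero j]
      exact extend_last _ _ 0
    · funext j
      refine Fin.lastCases (motive := fun j => extend _ _ k.succ j = A k.succ j) ?_ (fun j => ?_) j
      · exact extend_last _ _ _
      · exact extend_castSucc _ _ _ _

theorem extendEquiv_apply (p : (Fin (n + 1) → ℕ) × TriArray n) :
    extendEquiv n p = extend p.1 p.2 := rfl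

variable (D : Fin (n + 1) → ℕ) (B : TriArray n)

theorem extend_mk_last {k : ℕ} (hk : k < n + 1) (hj : k < k + 1) :
    extend D B ⟨k, hk⟩ ⟨k, hj⟩ = D ⟨k, hk⟩ := extend_last D B ⟨k, hk⟩

theorem extend_mk_succ {k j : ℕ} (hk : k + 1 < n + 1) (hj : j < k + 1) (hj' : j < k + 1 + 1) :
    extend D B ⟨k + 1, hk⟩ ⟨j, hj'⟩ = B ⟨k, Nat.lt_of_succ_lt_succ hk⟩ ⟨j, hj⟩ :=
  extend_castSucc D B ⟨k, Nat.lt_of_succ_lt_succ hk⟩ ⟨j, hj⟩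

theorem rowSum_extend : (extend D B).rowSum = D + Fin.cons 0 B.rowSum := by
  funext i
  refine Fin.cases ?_ (fun i => ?_) i
  · simp only [rowSum, Pi.add_apply, Fin.cons_zero, add_zero]
    exact (Fin.sum_univ_castSucc (n := 0) _).trans ((zero_add _).trans (extend_last D B 0))
  · simp only [rowSum, Pi.add_apply, Fin.cons_succ]
    refine (Fin.sum_univ_castSucc _).trans ?_
    rw [add_comm]
    congr 1
    · exact extend_last D B i.succ
    · exact Finset.sum_congr rfl fun j _ => extend_castSucc D B i j

theorem colSum_extend_castSucc (i : Fin n) :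
    (extend D B).colSum i.castSucc = D i.castSucc + B.colSum i := by
  obtain ⟨i, hi⟩ := i
  have h : ∀ k : Fin n, (if h : i ≤ k.val + 1 then
      extend D B k.succ ⟨i, Nat.lt_succ_of_le h⟩ else 0) =
      (if i = k.val + 1 then D ⟨i, hi.trans n.lt_succ_self⟩ else 0) +
        if h : i ≤ k.val then B k ⟨i, Nat.lt_succ_of_le h⟩ else 0 := by
    intro k
    rcases lt_trichotomy i (k.val + 1) with h | rfl | h
    · rw [dif_pos h.le, if_neg h.ne, dif_pos (Nat.le_of_lt_succ h), zero_add]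
      exact extend_mk_succ D B k.succ.isLt h _
    · rw [dif_pos le_rfl, if_pos rfl, dif_neg (by omega), add_zero]
      exact extend_mk_last D B _ _
    · rw [dif_neg (by omega), if_neg (by omega), dif_neg (by omega)]
  simp only [colSum, Fin.castSucc_mk]
  rw [Fin.sum_univ_succ]
  simp only [Fin.val_succ, Fin.val_zero]
  rw [Finset.sum_congr rfl fun k _ => h k, Finset.sum_add_distrib, ← add_assoc]
  congr 1
  rcases i with _ | i
  · simpa using extend_last D B 0
  · have h0 : ¬ i + 1 ≤ ((0 : Fin (n + 1)) : ℕ) := by simp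
    refine (congrArg₂ (· + ·) (dif_neg h0) rfl).trans ?_
    rw [zero_add, Finset.sum_eq_single ⟨i, (Nat.lt_succ_self i).trans hi⟩ (fun k _ hk => if_neg fun h =>
        hk (Fin.ext (by simp only; omega))) (by simp)]
    simp

theorem colSum_extend_last : (extend D B).colSum (Fin.last n) = D (Fin.last n) := by
  rw [colSum, Finset.sum_eq_single (Fin.last n)]
  · rw [dif_pos le_rfl]
    exact extend_last D B (Fin.last n)
  · intro k _ hk
    have : k.val < n := Fin.val_lt_last hk
    rw [dif_neg (by simp only [Fin.val_last]; omega)]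
  · simp

theorem diag_extend_last : (extend D B).diag (Fin.last n) = D := by
  funext j
  -- The row index becomes a variable, so that its value can be substituted although the type of the
  -- column index depends on it.
  have h : ∀ (k : ℕ) (hk : k < n + 1) (hj : j.val < k + 1), k = j.val →
      extend D B ⟨k, hk⟩ ⟨j.val, hj⟩ = D j := by
    rintro k hk hj rfl
    exact extend_mk_last D B _ _
  exact h _ _ _ (by simp)

theorem diag_extend_castSucc (i : Fin n) : (extend D B).diag i.castSucc = B.diag i := by
  funext j
  have h : ∀ (k m : ℕ) (hk : k < n + 1) (hm : m < n) (hj : j.val < k + 1) (hj' : j.val < m + 1),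
      k = m + 1 → extend D B ⟨k, hk⟩ ⟨j.val, hj⟩ = B ⟨m, hm⟩ ⟨j.val, hj'⟩ := by
    rintro k m hk hm hj hj' rfl
    exact extend_mk_succ D B _ _ _
  refine h _ _ _ _ _ _ ?_
  have := i.isLt
  simp only [Fin.val_castSucc]
  omega

/-- The shorter diagonals are untouched and each column gains one entry of `D`, so the powers of the
rates split. One factor `x 0` goes with the new diagonal. -/
theorem weight_extend (r : ℕ → ℝ≥0) :
    weight (fun j => (r j : ℝ)) (extend D B) =
      geomMultinomial r (n + 1) D * weight (fun j => (r j : ℝ)) B := by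
  simp only [weight, geomMultinomial, diagSum]
  rw [Fin.prod_univ_castSucc]
  simp only [diag_extend_castSucc, diag_extend_last, colSum_extend_castSucc, colSum_extend_last,
    Fin.val_castSucc, Fin.val_last, pow_add, Finset.prod_mul_distrib, Finset.prod_div_distrib]
  push_cast
  rw [Fin.prod_univ_castSucc]
  simp only [Fin.val_castSucc, Fin.val_last]
  ring

theorem weight_coe_nonneg (r : ℕ → ℝ≥0) (A : TriArray n) :
    0 ≤ weight (fun j => (r j : ℝ)) A := by
  unfold weight
  have : 0 ≤ ∑ i ∈ Finset.range n, (r i : ℝ) := by positivity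
  exact mul_nonneg (by positivity) (Finset.prod_nonneg fun i _ => by positivity)

theorem weight_congr {x x' : ℕ → ℝ} (h : ∀ j ≤ n, x j = x' j) (A : TriArray n) :
    weight x A = weight x' A := by
  unfold weight
  rw [h 0 (Nat.zero_le n)]
  congr 1
  refine Finset.prod_congr rfl fun k _ => ?_
  rw [h _ k.isLt, Finset.sum_congr rfl fun i hi => h i (by
    have := Finset.mem_range.1 hi
    omega)]

end TriArray

/-! ### The stationary distribution -/

section Stationary

theorem pmf_tsum_bind_mul {α β : Type*} (p : PMF α) (q : α → PMF β) (f : β → ℝ≥0∞) :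
    ∑' b, p.bind q b * f b = ∑' a, p a * ∑' b, q a b * f b := by
  simp_rw [PMF.bind_apply, ← ENNReal.tsum_mul_right, ← ENNReal.tsum_mul_left]
  rw [ENNReal.tsum_comm]
  simp_rw [mul_assoc]

theorem pmf_tsum_map_mul {α β : Type*} (p : PMF α) (g : α → β) (f : β → ℝ≥0∞) :
    ∑' b, p.map g b * f b = ∑' a, p a * f (g a) := by
  rw [PMF.map, pmf_tsum_bind_mul]
  refine tsum_congr fun a => ?_
  congr 1
  rw [tsum_eq_single (g a) fun b hb => by simp [PMF.pure_apply, hb]]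
  simp [PMF.pure_apply]

variable {r : ℕ → ℝ≥0} (hr0 : r 0 ≠ 0)

/-- The distribution with mass function `geomMultinomial r k`. -/
noncomputable def geomMultinomialPMF (k : ℕ) : PMF (Fin k → ℕ) :=
  ⟨fun D => geomMultinomial r k D, by
    simpa [tsum_geomMultinomial hr0] using ENNReal.summable.hasSum
      (f := fun D : Fin k → ℕ => (geomMultinomial r k D : ℝ≥0∞))⟩

/-- The law of the contents of the first `n` bins, obtained by adding up the balls inserted between
shifts of the past: the most recent ones are in the bins in which they were inserted, and the
earlier ones have been shifted at least once. -/
noncomputable def boardPMF : (n : ℕ) → PMF (Fin n → ℕ)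
  | 0 => PMF.pure 0
  | n + 1 => (geomMultinomialPMF hr0 (n + 1)).bind fun D =>
      (boardPMF n).map fun c => D + Fin.cons 0 c

theorem tsum_boardPMF_succ (n : ℕ) (f : (Fin (n + 1) → ℕ) → ℝ≥0∞) :
    ∑' c, boardPMF hr0 (n + 1) c * f c =
      ∑' D, (geomMultinomial r (n + 1) D : ℝ≥0∞) *
        ∑' c, boardPMF hr0 n c * f (D + Fin.cons 0 c) := by
  rw [boardPMF, pmf_tsum_bind_mul]
  simp_rw [pmf_tsum_map_mul]
  rfl

theorem tsum_boardPMF (n : ℕ) (f : (Fin n → ℕ) → ℝ≥0∞) :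
    ∑' c, boardPMF hr0 n c * f c =
      ∑' A : TriArray n, ENNReal.ofReal (A.weight fun j => r j) * f A.rowSum := by
  induction n with
  | zero =>
    rw [tsum_fintype, tsum_fintype, Fintype.sum_unique, Fintype.sum_unique]
    rw [boardPMF, PMF.pure_apply, if_pos (Subsingleton.elim _ _),
      Subsingleton.elim (TriArray.rowSum _) default]
    simp only [TriArray.weight, pow_zero, Finset.univ_eq_empty, Finset.prod_empty, mul_one,
      ENNReal.ofReal_one]
    exact congrArg (fun c => 1 * f c) (Subsingleton.elim _ _)
  | succ n ih =>
    rw [tsum_boardPMF_succ, ← (TriArray.extendEquiv n).tsum_eq, ENNReal.tsum_prod']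
    refine tsum_congr fun D => ?_
    rw [ih, ← ENNReal.tsum_mul_left]
    refine tsum_congr fun B => ?_
    rw [TriArray.extendEquiv_apply, TriArray.weight_extend, TriArray.rowSum_extend,
      ENNReal.ofReal_mul (NNReal.coe_nonneg _), ENNReal.ofReal_coe_nnreal, mul_assoc]

theorem boardPMF_apply_toReal (n : ℕ) (c : Fin n → ℕ) :
    (boardPMF hr0 n c).toReal =
      ∑ A ∈ TriArray.withRowSums c, A.weight fun j => r j := by
  classical
  have h := tsum_boardPMF hr0 n (Set.indicator {c} 1)
  rw [tsum_eq_single c fun d hd => by simp [hd],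
    tsum_eq_sum (s := TriArray.withRowSums c) fun A hA => by
      rw [TriArray.mem_withRowSums] at hA
      rw [Set.indicator_of_notMem (s := {c}) (fun h => hA (congrFun h)), mul_zero]] at h
  rw [Finset.sum_congr rfl fun A hA => by
    rw [show A.rowSum = c from funext ((TriArray.mem_withRowSums c A).1 hA)]] at h
  simp only [Set.mem_singleton_iff, Set.indicator_of_mem, Pi.one_apply, mul_one] at h
  rw [h, ENNReal.toReal_sum fun A _ => ENNReal.ofReal_ne_top]
  exact Finset.sum_congr rfl fun A _ => ENNReal.toReal_ofReal (TriArray.weight_coe_nonneg r A)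

theorem cons_zero_init {n : ℕ} (c : Fin (n + 1) → ℕ) :
    Fin.init (Fin.cons 0 c : Fin (n + 2) → ℕ) = Fin.cons 0 (Fin.init c) := by
  funext i
  refine Fin.cases ?_ (fun i => ?_) i
  · simp [Fin.init]
  · simp [Fin.init]

/-- Dropping the last bin of `D + (0, c)` leaves `init D + (0, init c)`; the marginal of
`geomMultinomial` handles `D`, and induction handles `c`. -/
theorem tsum_boardPMF_mul_init (n : ℕ) (g : (Fin n → ℕ) → ℝ≥0∞) :
    ∑' c, boardPMF hr0 (n + 1) c * g (Fin.init c) = ∑' c, boardPMF hr0 n c * g c := by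
  induction n with
  | zero =>
    have h : ∀ c, g c = g 0 := fun c => by rw [Subsingleton.elim c 0]
    simp_rw [h, ENNReal.tsum_mul_right, PMF.tsum_coe]
  | succ n ih =>
    rw [tsum_boardPMF_succ hr0 n, tsum_boardPMF_succ,
      ← tsum_geomMultinomial_mul_init hr0 (n + 1) fun D =>
        ∑' c, boardPMF hr0 n c * g (D + (Fin.cons 0 c : Fin (n + 1) → ℕ))]
    refine tsum_congr fun D => ?_
    congr 1
    rw [← ih fun c => g (Fin.init D + (Fin.cons 0 c : Fin (n + 1) → ℕ))]
    refine tsum_congr fun c => ?_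
    rw [← cons_zero_init]
    rfl

theorem tsum_boardPMF_mul_castLE {l n : ℕ} (hl : l ≤ n) (g : (Fin l → ℕ) → ℝ≥0∞) :
    ∑' c, boardPMF hr0 n c * g (fun i => c (Fin.castLE hl i)) =
      ∑' c, boardPMF hr0 l c * g c := by
  induction n, hl using Nat.le_induction with
  | base => rfl
  | succ n hl ih =>
    rw [← ih, ← tsum_boardPMF_mul_init hr0 n]
    rfl

theorem toMeasure_boardPMF_cylinder {l n : ℕ} (hl : l ≤ n) (c : Fin l → ℕ) :
    (boardPMF hr0 n).toMeasure {z | ∀ i : Fin l, z (Fin.castLE hl i) = c i} =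
      boardPMF hr0 l c := by
  rw [PMF.toMeasure_apply _ (Set.to_countable _).measurableSet]
  have h := tsum_boardPMF_mul_castLE hr0 hl (Set.indicator {c} 1)
  rw [tsum_eq_single c fun d hd => by simp [hd]] at h
  simp only [Set.mem_singleton_iff, Set.indicator_of_mem, Pi.one_apply, mul_one] at h
  rw [← h]
  refine tsum_congr fun z => ?_
  simp [Set.indicator_apply, funext_iff]

end Stationary

/-! ### The board -/

section Board

theorem boardMap_zero {n : ℕ} (c : Fin (n + 1) → ℕ) :
    boardMap (0 : Fin (n + 2)) c = Fin.cons 0 (Fin.init c) := by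
  funext i
  refine Fin.cases ?_ (fun i => ?_) i
  · simp [boardMap]
  · simp only [boardMap, Fin.val_zero, if_true, Fin.val_succ, Nat.succ_ne_zero, if_false,
      Fin.cons_succ, Fin.init]
    rfl

theorem boardMap_succ {n : ℕ} (j : Fin n) (c : Fin n → ℕ) :
    boardMap j.succ c = c + Pi.single j 1 := by
  funext i
  by_cases h : i = j
  · subst h
    simp [boardMap]
  · simp [boardMap, h, Fin.val_inj]

theorem iterate_boardMap_zero {n : ℕ} (c : Fin n → ℕ) : (boardMap 0)^[n] c = 0 := by
  have h : ∀ (k : ℕ) (i : Fin n), i.val < k → (boardMap 0)^[k] c i = 0 := by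
    intro k
    induction k with
    | zero => simp
    | succ k ih =>
      intro i hi
      rw [Function.iterate_succ_apply']
      simp only [boardMap, Fin.val_zero, if_true]
      split_ifs with h0
      · rfl
      · exact ih _ (by simp only; omega)
  exact funext fun i => h n i i.isLt

variable {r : ℕ → ℝ≥0}

/-- Induction on the number `k` of bins that may be nonempty: a shift takes `(d_2, …, d_{n+1}, 0)`
to `(0, d_2, …, d_{n+1})`, and `d_1` insertions into bin 1 complete `d`. -/
theorem isUniformlyAccessible_board (hr0 : r 0 ≠ 0) (hr1 : r 1 ≠ 0) {n : ℕ}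
    (d : Fin (n + 1) → ℕ) :
    IsUniformlyAccessible (fun j : Fin (n + 2) => (r j.val : ℝ)) boardMap d := by
  have hr : ∀ j : Fin (n + 2), 0 ≤ (r j.val : ℝ) := fun j => NNReal.coe_nonneg _
  have h0 : 0 < (r (0 : Fin (n + 2)).val : ℝ) := NNReal.coe_pos.2 (pos_iff_ne_zero.2 hr0)
  have h1 : 0 < (r (Fin.succ (0 : Fin (n + 1))).val : ℝ) :=
    NNReal.coe_pos.2 (pos_iff_ne_zero.2 hr1)
  have key : ∀ (k : ℕ) (d : Fin (n + 1) → ℕ), (∀ i : Fin (n + 1), k ≤ i.val → d i = 0) →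
      IsUniformlyAccessible (fun j : Fin (n + 2) => (r j.val : ℝ)) boardMap d := by
    intro k
    induction k with
    | zero =>
      intro d hd
      exact isUniformlyAccessible_of_iterate hr h0 (n + 1) fun c => by
        rw [iterate_boardMap_zero]
        exact (funext fun i => hd i (Nat.zero_le _)).symm
    | succ k ih =>
      intro d hd
      have h2 : ∀ a : ℕ, IsUniformlyAccessible (fun j : Fin (n + 2) => (r j.val : ℝ)) boardMap
          (Fin.cons a (Fin.tail d)) := by
        intro a
        induction a with
        | zero =>
          have h3 := (ih (Fin.snoc (Fin.tail d) 0) fun i => by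
            refine Fin.lastCases ?_ (fun i hi => ?_) i
            · simp
            · rw [Fin.snoc_castSucc]
              exact hd _ (by simpa using hi)).map hr h0
          rwa [boardMap_zero, Fin.init_snoc] at h3
        | succ a iha =>
          have h3 := iha.map hr h1
          rw [boardMap_succ] at h3
          convert h3 using 1
          funext i
          refine Fin.cases ?_ (fun i => ?_) i <;> simp
      simpa using h2 (d 0)
  exact key (n + 1) d fun i hi => absurd i.isLt (not_lt.2 hi)

theorem boardPMF_balance (hr0 : r 0 ≠ 0) (n : ℕ) (g : (Fin (n + 1) → ℕ) → ℝ≥0∞) :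
    ∑' c, boardPMF hr0 (n + 1) c *
        ∑ j : Fin (n + 2), ENNReal.ofReal (r j.val) * g (boardMap j c) =
      ENNReal.ofReal (∑ j : Fin (n + 2), (r j.val : ℝ)) * ∑' c, boardPMF hr0 (n + 1) c * g c := by
  have hsum : ENNReal.ofReal (∑ j : Fin (n + 2), (r j.val : ℝ)) =
      (∑ i ∈ Finset.range (n + 1 + 1), r i : ℝ≥0) := by
    rw [Fin.sum_univ_eq_sum_range (fun i => (r i : ℝ)), ← NNReal.coe_sum,
      ENNReal.ofReal_coe_nnreal]
  have hswap : ∀ f : (Fin (n + 1) → ℕ) → (Fin n → ℕ) → ℝ≥0∞,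
      ∑' D, (geomMultinomial r (n + 1) D : ℝ≥0∞) * ∑' c, boardPMF hr0 n c * f D c =
        ∑' c, boardPMF hr0 n c * ∑' D, (geomMultinomial r (n + 1) D : ℝ≥0∞) * f D c := by
    intro f
    simp_rw [← ENNReal.tsum_mul_left]
    rw [ENNReal.tsum_comm]
    simp_rw [mul_left_comm]
  simp_rw [Finset.mul_sum, ENNReal.ofReal_coe_nnreal]
  rw [Summable.tsum_finsetSum fun _ _ => ENNReal.summable, Fin.sum_univ_succ]
  simp_rw [mul_left_comm (boardPMF hr0 (n + 1) _), ENNReal.tsum_mul_left, boardMap_zero,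
    boardMap_succ]
  -- A shift forgets the last bin, so it sees only the law of the smaller board; insertions act on
  -- `D` alone. Both sides become averages over `c`, compared term by term.
  rw [tsum_boardPMF_mul_init hr0 n fun c => g (Fin.cons 0 c), tsum_boardPMF_succ hr0 n g, hsum]
  simp_rw [tsum_boardPMF_succ hr0 n, hswap]
  rw [← ENNReal.tsum_mul_left, ← ENNReal.tsum_mul_left]
  simp_rw [← ENNReal.tsum_mul_left (a := (r _ : ℝ≥0∞))]
  rw [← Summable.tsum_finsetSum fun _ _ => ENNReal.summable, ← ENNReal.tsum_add]
  refine tsum_congr fun c => ?_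
  refine Eq.trans ?_ ((congrArg (boardPMF hr0 n c * ·) (tsum_geomMultinomial_balance hr0 (n + 1)
    fun D => g (D + (Fin.cons 0 c : Fin (n + 1) → ℕ)))).trans (mul_left_comm _ _ _))
  simp only [mul_add, Finset.mul_sum]
  simp only [zero_add, Fin.val_zero, Fin.val_succ]
  congr 1
  · ring
  · refine Finset.sum_congr rfl fun j _ => ?_
    rw [mul_left_comm]
    simp_rw [add_right_comm _ (Fin.cons 0 c : Fin (n + 1) → ℕ)]

end Board

end HilbertGalton

/-! ### The theorem for real rates -/

theorem theorem2p2 (n : ℕ) (hn : 1 ≤ n) (x : ℕ → ℝ) (hx : ∀ j ≤ n, 0 ≤ x j)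
    (hx0 : 0 < x 0) (hx1 : 0 < x 1) :
    HilbertGalton.IsIrreducible (HilbertGalton.board n x) ∧
    HilbertGalton.IsPositiveRecurrent (HilbertGalton.board n x) ∧
    ∃ π : PMF (Fin n → ℕ),
      HilbertGalton.IsStationary (HilbertGalton.board n x) π ∧
      (∀ π' : PMF (Fin n → ℕ), HilbertGalton.IsStationary (HilbertGalton.board n x) π' → π' = π) ∧
      (∀ c : Fin n → ℕ,
        (π c).toReal
          = ∑ A ∈ HilbertGalton.TriArray.withRowSums c, HilbertGalton.TriArray.weight x A) ∧
      (∀ (l : ℕ) (_ : 1 ≤ l) (hl : l ≤ n) (c : Fin l → ℕ),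
        (π.toMeasure {z | ∀ i : Fin l, z (Fin.castLE hl i) = c i}).toReal
          = ∑ A ∈ HilbertGalton.TriArray.withRowSums c, HilbertGalton.TriArray.weight x A) := by
  open HilbertGalton in
  obtain ⟨n, rfl⟩ : ∃ m, n = m + 1 := ⟨n - 1, by omega⟩
  -- Truncation can change `x j` only for `j > n`, in the notation of the statement; neither the
  -- generator nor the weights involve these values.
  set r : ℕ → ℝ≥0 := fun j => (x j).toNNReal with hr_def
  have hxr : ∀ j ≤ n + 1, x j = r j := fun j hj => (Real.coe_toNNReal _ (hx j hj)).symm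
  have hr0 : r 0 ≠ 0 := (Real.toNNReal_pos.2 hx0).ne'
  have hr1 : r 1 ≠ 0 := (Real.toNNReal_pos.2 hx1).ne'
  have hboard : board (n + 1) x = generator (fun j : Fin (n + 2) => (r j.val : ℝ)) boardMap := by
    rw [board]
    congr 1
    exact funext fun j => hxr _ (Nat.le_of_lt_succ j.isLt)
  have hr : ∀ j : Fin (n + 2), 0 ≤ (r j.val : ℝ) := fun j => NNReal.coe_nonneg _
  have hacc := isUniformlyAccessible_board hr0 hr1 (n := n)
  have hstat : IsStationary (board (n + 1) x) (boardPMF hr0 (n + 1)) := by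
    rw [hboard]
    exact isStationary_of_balance hr boardMap _ (boardPMF_balance hr0 n)
  have hformula : ∀ l ≤ n + 1, ∀ c : Fin l → ℕ, (boardPMF hr0 l c).toReal =
      ∑ A ∈ TriArray.withRowSums c, A.weight x := fun l hl c => by
    rw [boardPMF_apply_toReal]
    exact Finset.sum_congr rfl fun A _ =>
      (TriArray.weight_congr (fun j hj => hxr j (hj.trans hl)) A).symm
  refine ⟨?_, ?_, boardPMF hr0 (n + 1), hstat, fun π' hπ' => ?_, hformula _ le_rfl,
    fun l _ hl c => ?_⟩
  · rw [hboard]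
    exact isIrreducible_of_isUniformlyAccessible hr hacc
  · rw [hboard]
    exact isPositiveRecurrent_of_minorization (fun c d => transProb_nonneg hr boardMap 1 c d)
      fun d => (hacc d).exists_le_transProb hr
  · rw [hboard] at hstat hπ'
    exact stationary_unique_of_isUniformlyAccessible hr (hacc 0) hstat hπ'
  · rw [toMeasure_boardPMF_cylinder, hformula l hl]
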